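/- For integers $m\ge 0$ let $H_n=1+\tfrac12+\cdots+\tfrac1n$ and $$\mathcal H^m(s)=\sum_{n=1}^{\infty}\frac{H_n^m}{n^s}\qquad(\Re s>1).$$ The series converges for $\Re s>1$ and $\mathcal H^m$ extends to a meromorphic function on $\mathbb C$. For integers $n\ge 0$ and $k\ge 1$ let $\mathrm H^m(1-n,k)$ denote the coefficient of $(s-1+n)^{-k}$ in the Laurent expansion of $\mathcal H^m(s)$ at $s=1-n$. Let $\gamma$ be the Euler–Mascheroni constant and $\zeta$ the Riemann zeta function. Define $a_n(\ell)$ for $n,\ell\ge 0$ by $a_0(0)=1$, $a_n(0)=0$ for $n\ge 1$, and $$a_n(\ell+1)=\sum_{k=1}^{n-\ell}(-1)^k\zeta(1-k)\,a_{n-k}(\ell)$$ (an empty sum being $0$), and for $k\ge 1$ put $$a_n(\ell,k)=\ell(\ell-1)\cdots(\ell-k+2)\,a_n(\ell-k+1),$$ where the product has $k-1$ factors (so it is $1$ for $k=1$), and $a_n(\ell,k)=0$ if $\ell<k-1$. Then all $a_n(\ell,k)$ are rational numbers, and for all $m,n\ge 0$ and $k\ge 1$ $$\mathrm H^m(1-n,k)=\sum_{\ell=0}^m\binom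 m\ell\gamma^{m-\ell}a_n(\ell,k).$$ Moreover, with the formal power series $f(x)=\sum_{n\ge 1}(-1)^n\zeta(1-n)x^n$, for all $m,k\ge 0$ $$\sum_{n=0}^{\infty}\mathrm H^m(1-n,k+1)\,x^n=m(m-1)\cdots(m-k+1)\,(\gamma+f(x))^{m-k}$$ as formal power series, where the product has $k$ factors and the right-hand side is $0$ if $k>m$. -/

import Mathlib

open Filter Topology

noncomputable section

/-- `F` is the `m`-th power harmonic zeta function `∑ Hₙ ^ m / n ^ s`: a meromorphic function on the
whole complex plane that is the sum of the (convergent) Dirichlet series for `Re s > 1`.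
Its values at the poles are irrelevant. -/
structure IsHarmonicZeta (m : ℕ) (F : ℂ → ℂ) : Prop where
  meromorphic : MeromorphicOn F Set.univ
  hasSum : ∀ s : ℂ, 1 < s.re → LSeriesHasSum (fun n : ℕ => (harmonic n : ℂ) ^ m) s (F s)

/-- `b j` is the coefficient of `(z - c) ^ j`, for all integers `j`, in the Laurent expansion at `c`
of a function with at most a pole at `c`. -/
def HasLaurentExpansionAt (F : ℂ → ℂ) (c : ℂ) (b : ℤ → ℂ) : Prop :=
  (∃ N : ℤ, ∀ j < N, b j = 0) ∧
    ∀ᶠ z in 𝓝[≠] c, HasSum (fun j : ℤ => b j * (z - c) ^ j) (F z)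

/-- The double sequence `a n ℓ = aₙ(ℓ)`, given by `aₙ(0) = 1` if `n = 0` and `0` otherwise, and
`aₙ(ℓ + 1) = ∑_{k = 1}^{n - ℓ} (-1) ^ k ζ(1 - k) aₙ₋ₖ(ℓ)` (an empty sum if `n ≤ ℓ`). -/
def poleSeq : ℕ → ℕ → ℂ
  | n, 0 => if n = 0 then 1 else 0
  | n, ℓ + 1 => ∑ k ∈ Finset.Icc 1 (n - ℓ), (-1) ^ k * riemannZeta (1 - k) * poleSeq (n - k) ℓ

/-- The triple sequence `aₙ(ℓ, k) = ℓ (ℓ - 1) ⋯ (ℓ - k + 2) aₙ(ℓ - k + 1)` for `k ≥ 1`.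
The product has `k - 1` factors; it is empty for `k = 1`, and vanishes if `ℓ < k - 1`. -/
def poleTripleSeq (n ℓ k : ℕ) : ℂ :=
  (ℓ.descFactorial (k - 1) : ℂ) * poleSeq n (ℓ - (k - 1))

/-- The formal power series `f(x) = ∑_{n ≥ 1} (-1) ^ n ζ(1 - n) x ^ n`. -/
def zetaPowerSeries : PowerSeries ℂ :=
  PowerSeries.mk fun n => if n = 0 then 0 else (-1) ^ n * riemannZeta (1 - n)

end

/-!
The principal parts of `∑ Hₙ ^ m / n ^ s` can be read off from the asymptotic expansion of `Hₙ`.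
With `f(x) = ∑ (-1) ^ n ζ(1 - n) x ^ n = -∑ (Bₙ / n) x ^ n`, one has `Hₙ ∼ log n + γ + f(1 / n)`
(`hasInvExpansion_harmonic_sub_log`). Indeed, the increments of the truncated expansion differ from
`1 / n` by a power series in `1 / n` whose low coefficients vanish, which is the recursion of the
Bernoulli numbers (`sum_bernoulli_div_mul_choose`), and summing the tail gives the error term.

By the binomial theorem, `Hₙ ^ m ∼ ∑ₖ (m choose k) (log n) ^ k (γ + f(1 / n)) ^ (m - k)`. The
Dirichlet series of `(log n) ^ k / n ^ j` is the `k`-th derivative of `ζ` at `s + j`, up to the sign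
`(-1) ^ k`; it continues to `ℂ` with principal part `k! / (s + j - 1) ^ (k + 1)`
(`LSeriesHasSum_log_pow_mul_inv_pow`). The remainder of order `n ^ (-J)`, up to logarithms,
contributes a function that is holomorphic on `2 - J < Re s`. This continues the series to each such
half-plane, and at `1 - n` only the term `j = n` has a pole
(`exists_harmonicZeta_eq_principalPart_add`), so the coefficient of `(s - 1 + n) ^ (-(k + 1))` is
`k! (m choose k)` times that of `x ^ n` in `(γ + f(x)) ^ (m - k)`.

The identity theorem (`IsHarmonicZeta.eventuallyEq`) and the uniqueness of Laurent coefficients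
(`HasLaurentExpansionAt.unique`) transfer this to every continuation and every expansion. As
`aₙ(ℓ)` is the coefficient of `x ^ n` in `f(x) ^ ℓ` (`poleSeq_eq_coeff`), the finite formula is the
binomial expansion of the generating function (`sum_choose_mul_poleTripleSeq`), and rationality
is that of the Bernoulli numbers.
-/

/-! ### The coefficients of the power series `f` -/

theorem riemannZeta_one_sub_nat {n : ℕ} (hn : n ≠ 0) :
    (-1) ^ n * riemannZeta (1 - n) = ((-bernoulli n / n : ℚ) : ℂ) := by
  obtain ⟨k, rfl⟩ := Nat.exists_eq_succ_of_ne_zero hn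
  have h : (1 - ((k.succ : ℕ) : ℂ)) = -(k : ℂ) := by push_cast; ring
  have h1 : ((-1 : ℂ) ^ k) * (-1) ^ k = 1 := by rw [← mul_pow]; simp
  rw [h, riemannZeta_neg_nat_eq_bernoulli, pow_succ]
  push_cast
  linear_combination (-(bernoulli (k + 1) : ℂ) / (k + 1)) * h1

/-- The coefficients of `f` are `-Bₙ / n`, where `B₁ = -1 / 2`. -/
theorem coeff_zetaPowerSeries (n : ℕ) :
    PowerSeries.coeff n zetaPowerSeries = ((if n = 0 then 0 else -bernoulli n / n : ℚ) : ℂ) := by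
  rw [zetaPowerSeries, PowerSeries.coeff_mk]
  split_ifs with h
  · simp
  · exact riemannZeta_one_sub_nat h

theorem constantCoeff_zetaPowerSeries : PowerSeries.constantCoeff zetaPowerSeries = 0 := by
  rw [← PowerSeries.coeff_zero_eq_constantCoeff_apply, coeff_zetaPowerSeries]
  simp

/-- `aₙ(ℓ)` is the coefficient of `x ^ n` in `f(x) ^ ℓ`. -/
theorem poleSeq_eq_coeff (n ℓ : ℕ) :
    poleSeq n ℓ = PowerSeries.coeff n (zetaPowerSeries ^ ℓ) := by
  induction ℓ generalizing n with
  | zero => rw [poleSeq, pow_zero, PowerSeries.coeff_one]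
  | succ ℓ ih =>
    rw [poleSeq, pow_succ', PowerSeries.coeff_mul,
      Finset.Nat.sum_antidiagonal_eq_sum_range_succ_mk]
    have hsub : Finset.Icc 1 (n - ℓ) ⊆ Finset.range n.succ := by
      intro k; simp only [Finset.mem_Icc, Finset.mem_range]; omega
    rw [← Finset.sum_subset hsub]
    · refine Finset.sum_congr rfl fun k hk => ?_
      have hk0 : k ≠ 0 := by have := Finset.mem_Icc.mp hk; omega
      rw [ih, zetaPowerSeries, PowerSeries.coeff_mk, if_neg hk0]
    · intro k hk hk'
      simp only [Finset.mem_Icc, Finset.mem_range] at hk hk'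
      rcases Nat.eq_zero_or_pos k with rfl | hk0
      · simp [constantCoeff_zetaPowerSeries]
      -- the order of `f ^ ℓ` is at least `ℓ`, which exceeds `n - k`
      · dsimp only
        rw [PowerSeries.coeff_of_lt_order (n - k), mul_zero]
        refine lt_of_lt_of_le ?_ (PowerSeries.le_order_pow_of_constantCoeff_eq_zero ℓ
          constantCoeff_zetaPowerSeries)
        exact_mod_cast (by omega : n - k < ℓ)

theorem poleSeq_rational (n ℓ : ℕ) : ∃ q : ℚ, poleSeq n ℓ = (q : ℂ) := by
  let g : PowerSeries ℚ := PowerSeries.mk fun n => if n = 0 then 0 else -bernoulli n / n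
  have hg : zetaPowerSeries = PowerSeries.map (algebraMap ℚ ℂ) g := by
    ext n
    rw [coeff_zetaPowerSeries, PowerSeries.coeff_map, PowerSeries.coeff_mk]
    rfl
  refine ⟨PowerSeries.coeff n (g ^ ℓ), ?_⟩
  rw [poleSeq_eq_coeff, hg, ← map_pow, PowerSeries.coeff_map]
  rfl

/-- The binomial expansion of `m (m - 1) ⋯ (m - j + 1) (c + f) ^ (m - j)`, coefficientwise. -/
theorem sum_choose_mul_poleTripleSeq (c : ℂ) (m n j : ℕ) :
    ∑ ℓ ∈ Finset.range (m + 1), (m.choose ℓ : ℂ) * c ^ (m - ℓ) * poleTripleSeq n ℓ (j + 1) =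
      (m.descFactorial j : ℂ) *
        PowerSeries.coeff n ((PowerSeries.C c + zetaPowerSeries) ^ (m - j)) := by
  simp only [poleTripleSeq, Nat.add_sub_cancel]
  rcases lt_or_ge m j with h | h
  · rw [Nat.descFactorial_eq_zero_iff_lt.mpr h]
    simp only [Nat.cast_zero, zero_mul]
    refine Finset.sum_eq_zero fun ℓ hℓ => ?_
    rw [Nat.descFactorial_eq_zero_iff_lt.mpr (by have := Finset.mem_range.mp hℓ; omega)]
    simp
  obtain ⟨p, rfl⟩ := Nat.exists_eq_add_of_le h
  rw [show j + p + 1 = j + (p + 1) by ring, Finset.sum_range_add, Finset.sum_eq_zero, zero_add,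
    Nat.add_sub_cancel_left, add_comm (PowerSeries.C c), add_pow, map_sum, Finset.mul_sum]
  · refine Finset.sum_congr rfl fun i hi => ?_
    have hi : i ≤ p := by have := Finset.mem_range.mp hi; omega
    have hnat : (j + p).choose (j + i) * (j + i).descFactorial j =
        (j + p).descFactorial j * p.choose i := by
      rw [Nat.descFactorial_eq_factorial_mul_choose, Nat.descFactorial_eq_factorial_mul_choose]
      have := Nat.choose_mul (n := j + p) (k := j + i) (s := j) (by omega)
      simp only [Nat.add_sub_cancel_left] at this
      linear_combination (Nat.factorial j) * this
    have hc : (((j + p).choose (j + i) : ℕ) : ℂ) * ((j + i).descFactorial j : ℕ) =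
        ((j + p).descFactorial j : ℕ) * (p.choose i : ℕ) := by exact_mod_cast hnat
    rw [Nat.add_sub_add_left, Nat.add_sub_cancel_left, poleSeq_eq_coeff,
      ← map_natCast (PowerSeries.C (R := ℂ)), ← map_pow, PowerSeries.coeff_mul_C,
      PowerSeries.coeff_mul_C]
    linear_combination c ^ (p - i) * (PowerSeries.coeff n (zetaPowerSeries ^ i)) * hc
  · intro ℓ hℓ
    rw [Nat.descFactorial_eq_zero_iff_lt.mpr (Finset.mem_range.mp hℓ)]
    simp

/-! ### The asymptotic expansion of the harmonic numbers -/

/-- A function given on `(-1, 1)` by a power series without terms of degree at most `J + 1` is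
`O(x ^ (J + 2))`, uniformly for `|x| ≤ 1 / 2`. -/
theorem exists_abs_le_of_hasSum_pow {c : ℕ → ℝ} {φ : ℝ → ℝ} {J : ℕ}
    (h : ∀ x : ℝ, |x| < 1 → HasSum (fun M : ℕ => c M * x ^ (M + 1)) (φ x))
    (hc : ∀ M ≤ J, c M = 0) :
    ∃ C : ℝ, ∀ x : ℝ, |x| ≤ 1 / 2 → |φ x| ≤ C * |x| ^ (J + 2) := by
  have hs : Summable fun M : ℕ => |c (M + (J + 1))| * (1 / 2) ^ M := by
    have h1 := ((h (1 / 2) (by norm_num [abs_of_pos])).summable.abs)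
    have h2 := ((summable_nat_add_iff (J + 1)).mpr h1).mul_right (2 ^ (J + 2))
    refine h2.congr fun M => ?_
    rw [abs_mul, abs_of_pos (by positivity : (0 : ℝ) < (1 / 2) ^ (M + (J + 1) + 1)), mul_assoc,
      show M + (J + 1) + 1 = M + (J + 2) by ring, pow_add, mul_assoc, ← mul_pow]
    norm_num
  refine ⟨∑' M : ℕ, |c (M + (J + 1))| * (1 / 2) ^ M, fun x hx => ?_⟩
  have hx1 : |x| < 1 := by linarith
  have h1 := (hasSum_nat_add_iff' (J + 1)).mpr (h x hx1)
  rw [Finset.sum_eq_zero, sub_zero] at h1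
  · have h2 := hs.hasSum.mul_right (|x| ^ (J + 2))
    refine (h1.norm_le_of_bounded h2 fun M => ?_)
    rw [Real.norm_eq_abs, abs_mul, abs_pow, mul_assoc,
      show M + (J + 1) + 1 = M + (J + 2) by ring, pow_add]
    gcongr
  · intro M hM
    rw [hc M (by have := Finset.mem_range.mp hM; omega), zero_mul]

theorem hasSum_choose_mul_pow_succ (i : ℕ) {x : ℝ} (hx : |x| < 1) :
    HasSum (fun M : ℕ => (M.choose i : ℝ) * x ^ (M + 1)) ((x / (1 - x)) ^ (i + 1)) := by
  rw [← hasSum_nat_add_iff' i, Finset.sum_eq_zero, sub_zero, div_pow, div_eq_mul_one_div]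
  · have h := (hasSum_choose_mul_geometric_of_norm_lt_one i (r := x) hx).mul_left (x ^ (i + 1))
    refine h.congr_fun fun M => ?_
    rw [show M + i + 1 = i + 1 + M by ring, pow_add]
    ring
  · intro M hM
    rw [Nat.choose_eq_zero_of_lt (Finset.mem_range.mp hM)]
    simp

/-- The identity of formal power series behind the expansion of the harmonic numbers:
`∑ (-Bⱼ / j) ((x / (1 - x)) ^ j - x ^ j) = -log (1 - x) - x`, in terms of coefficients. -/
theorem sum_bernoulli_div_mul_choose (M : ℕ) :
    ∑ i ∈ Finset.range M, (-bernoulli (i + 1) / (i + 1 : ℕ) : ℚ) * (M.choose i : ℚ) =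
      1 / (M + 1) - if M = 0 then 1 else 0 := by
  have h := sum_bernoulli (M + 1)
  rw [Finset.sum_range_succ'] at h
  have hM : ((M : ℚ) + 1) ≠ 0 := by positivity
  have h2 : ∑ i ∈ Finset.range M, (-bernoulli (i + 1) / (i + 1 : ℕ) : ℚ) * (M.choose i : ℚ) =
      -(1 / (M + 1)) * ∑ i ∈ Finset.range M, ((M + 1).choose (i + 1) : ℚ) * bernoulli (i + 1) := by
    rw [Finset.mul_sum]
    refine Finset.sum_congr rfl fun i _ => ?_
    have h3 : ((M : ℚ) + 1) * M.choose i = (M + 1).choose (i + 1) * (i + 1) := by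
      exact_mod_cast Nat.add_one_mul_choose_eq M i
    have hi : ((i : ℚ) + 1) ≠ 0 := by positivity
    push_cast
    field_simp
    linear_combination (-bernoulli (i + 1)) * h3
  rw [h2, eq_sub_of_add_eq h]
  rcases Nat.eq_zero_or_pos M with rfl | hM0
  · simp
  · have : M ≠ 0 := by omega
    simp [this]

/-- At `x = 1 / (n + 1)`, the left-hand side is the amount by which the increment from `n` to `n + 1`
of the truncated expansion of the harmonic numbers differs from `1 / (n + 1)`. -/
theorem exists_abs_log_sub_le (J : ℕ) :
    ∃ C : ℝ, ∀ x : ℝ, |x| ≤ 1 / 2 →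
      |-Real.log (1 - x) - x - ∑ i ∈ Finset.range J, ((-bernoulli (i + 1) / (i + 1 : ℕ) : ℚ) : ℝ) *
        ((x / (1 - x)) ^ (i + 1) - x ^ (i + 1))| ≤ C * |x| ^ (J + 2) := by
  refine exists_abs_le_of_hasSum_pow (J := J) (c := fun M => 1 / (M + 1) - (if M = 0 then 1 else 0)
    - ∑ i ∈ Finset.range J, ((-bernoulli (i + 1) / (i + 1 : ℕ) : ℚ) : ℝ) *
      ((M.choose i : ℝ) - if M = i then 1 else 0)) (fun x hx => ?_) fun M hM => ?_
  · have hmono : ∀ i : ℕ, HasSum (fun M : ℕ => (if M = i then (1 : ℝ) else 0) * x ^ (M + 1))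
        (x ^ (i + 1)) := fun i => by
      convert hasSum_ite_eq i (x ^ (i + 1)) using 2 with M
      split_ifs with h
      · rw [h, one_mul]
      · rw [zero_mul]
    have h1 := ((Real.hasSum_pow_div_log_of_abs_lt_one hx).sub (hmono 0)).sub
      (hasSum_sum (s := Finset.range J) fun i _ =>
        ((hasSum_choose_mul_pow_succ i hx).sub (hmono i)).mul_left
          ((-bernoulli (i + 1) / (i + 1 : ℕ) : ℚ) : ℝ))
    rw [zero_add, pow_one] at h1
    refine h1.congr_fun fun M => ?_
    rw [sub_mul, sub_mul, Finset.sum_mul]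
    congr 1
    · ring
    · exact Finset.sum_congr rfl fun i _ => by ring
  · have h := congrArg (fun q : ℚ => (q : ℝ)) (sum_bernoulli_div_mul_choose M)
    have hsub : Finset.range M ⊆ Finset.range J := Finset.range_subset_range.mpr hM
    rw [← Finset.sum_subset hsub]
    · rw [Finset.sum_congr rfl (g := fun i => (((-bernoulli (i + 1) / (i + 1 : ℕ) : ℚ) *
        (M.choose i : ℚ) : ℚ) : ℝ)), ← Rat.cast_sum, h]
      · push_cast
        split_ifs <;> simp
      · intro i hi
        have : M ≠ i := (Finset.mem_range.mp hi).ne'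
        rw [if_neg this]
        push_cast
        ring
    · intro i _ hi
      rw [Finset.mem_range, not_lt] at hi
      rcases hi.eq_or_lt with rfl | hi
      · simp
      · simp [Nat.choose_eq_zero_of_lt hi, hi.ne]

/-- A sequence whose increments are bounded by those of a summable power converges at the rate
of the corresponding tail. -/
theorem abs_sub_le_of_abs_succ_sub_le {D : ℕ → ℝ} {C L : ℝ} {J : ℕ} (hD : Tendsto D atTop (𝓝 L))
    (h : ∀ n : ℕ, 1 ≤ n → |D (n + 1) - D n| ≤ C * ((n + 1 : ℝ)⁻¹) ^ (J + 2)) {n : ℕ} (hn : 1 ≤ n) :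
    |D n - L| ≤ C * ((n : ℝ)⁻¹) ^ (J + 1) := by
  have hn0 : (0 : ℝ) < n := by exact_mod_cast hn
  have hC : 0 ≤ C := by
    by_contra hC
    have := (abs_nonneg _).trans (h 1 le_rfl)
    have h2 : C * ((((1 : ℕ) : ℝ) + 1)⁻¹) ^ (J + 2) < 0 :=
      mul_neg_of_neg_of_pos (not_le.mp hC) (by positivity)
    linarith
  -- `1 / (M + 1) ^ (J + 2) ≤ (1 / n ^ J) (1 / M - 1 / (M + 1))` for `M ≥ n`, which telescopes
  have key : ∀ M, n ≤ M → |D M - D n| ≤ C * ((n : ℝ)⁻¹) ^ J * ((n : ℝ)⁻¹ - (M : ℝ)⁻¹) := by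
    intro M hM
    induction M, hM using Nat.le_induction with
    | base => simp
    | succ M hM ih =>
      have hM0 : (n : ℝ) ≤ M := by exact_mod_cast hM
      have hM1 : (0 : ℝ) < M := hn0.trans_le hM0
      have h1 := h M (hn.trans hM)
      have h2 : ((M + 1 : ℝ)⁻¹) ^ (J + 2) ≤ ((n : ℝ)⁻¹) ^ J * ((M : ℝ)⁻¹ - (M + 1 : ℝ)⁻¹) := by
        rw [pow_add]
        have h3 : ((M + 1 : ℝ)⁻¹) ^ 2 ≤ (M : ℝ)⁻¹ - (M + 1 : ℝ)⁻¹ := by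
          rw [inv_sub_inv hM1.ne' (by positivity), inv_pow, add_sub_cancel_left, one_div]
          exact inv_anti₀ (by positivity) (by nlinarith)
        have h4 : (M + 1 : ℝ)⁻¹ ≤ (n : ℝ)⁻¹ := inv_anti₀ hn0 (by linarith)
        gcongr
      have h5 := mul_le_mul_of_nonneg_left h2 hC
      have h6 : |D (M + 1) - D n| ≤ |D (M + 1) - D M| + |D M - D n| := abs_sub_le _ _ _
      push_cast
      linarith
  have hlim : Tendsto (fun M => |D M - D n|) atTop (𝓝 |L - D n|) :=
    (hD.sub_const _).abs
  rw [abs_sub_comm]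
  refine le_of_tendsto hlim ?_
  filter_upwards [eventually_ge_atTop n] with M hM
  refine (key M hM).trans ?_
  rw [pow_succ, ← mul_assoc]
  have : (0 : ℝ) ≤ (M : ℝ)⁻¹ := by positivity
  gcongr
  linarith

theorem exists_abs_harmonic_sub_le (J : ℕ) :
    ∃ C : ℝ, ∀ n : ℕ, 1 ≤ n →
      |(harmonic n : ℝ) - Real.log n - (Real.eulerMascheroniConstant +
        ∑ i ∈ Finset.range J, ((-bernoulli (i + 1) / (i + 1 : ℕ) : ℚ) : ℝ) *
          ((n : ℝ)⁻¹) ^ (i + 1))| ≤ C * ((n : ℝ)⁻¹) ^ (J + 1) := by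
  obtain ⟨C, hC⟩ := exists_abs_log_sub_le J
  refine ⟨C, fun n hn => ?_⟩
  rw [add_comm, ← sub_sub]
  refine abs_sub_le_of_abs_succ_sub_le (D := fun n : ℕ => (harmonic n : ℝ) - Real.log n -
    ∑ i ∈ Finset.range J, ((-bernoulli (i + 1) / (i + 1 : ℕ) : ℚ) : ℝ) *
      ((n : ℝ)⁻¹) ^ (i + 1)) ?_ (fun n hn => ?_) hn
  · have h1 : Tendsto (fun n : ℕ => ∑ i ∈ Finset.range J,
        ((-bernoulli (i + 1) / (i + 1 : ℕ) : ℚ) : ℝ) * ((n : ℝ)⁻¹) ^ (i + 1)) atTop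
        (𝓝 (∑ i ∈ Finset.range J,
          ((-bernoulli (i + 1) / (i + 1 : ℕ) : ℚ) : ℝ) * (0 : ℝ) ^ (i + 1))) :=
      tendsto_finsetSum _ fun i _ => (tendsto_inv_atTop_nhds_zero_nat.pow _).const_mul _
    simpa using Real.tendsto_harmonic_sub_log.sub h1
  · have hn0 : (0 : ℝ) < n := by exact_mod_cast hn
    have hx : |((n : ℝ) + 1)⁻¹| ≤ 1 / 2 := by
      rw [abs_of_pos (by positivity), ← one_div]
      have : (1 : ℝ) ≤ n := by exact_mod_cast hn
      exact one_div_le_one_div_of_le (by norm_num) (by linarith)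
    have h := hC _ hx
    have h1 : 1 - ((n : ℝ) + 1)⁻¹ = n / (n + 1) := by field_simp; ring
    have h2 : ((n : ℝ) + 1)⁻¹ / (n / (n + 1)) = (n : ℝ)⁻¹ := by field_simp
    rw [h1, h2, Real.log_div hn0.ne' (by positivity), abs_of_pos (a := ((n : ℝ) + 1)⁻¹)
      (by positivity)] at h
    rw [abs_sub_comm]
    refine le_trans (le_of_eq ?_) h
    congr 1
    simp only [harmonic_succ, mul_sub, Finset.sum_sub_distrib]
    push_cast
    ring

/-- `u` has the asymptotic expansion `∑ aⱼ / n ^ j` to every order, for `a = ∑ aⱼ x ^ j`. -/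
def HasInvExpansion (u : ℕ → ℂ) (a : PowerSeries ℂ) : Prop :=
  ∀ J : ℕ, (fun n : ℕ => u n - (PowerSeries.trunc J a).eval (n : ℂ)⁻¹) =O[atTop]
    fun n : ℕ => ((n : ℝ)⁻¹) ^ J

theorem isBigO_eval_inv_natCast (p : Polynomial ℂ) :
    (fun n : ℕ => p.eval (n : ℂ)⁻¹) =O[atTop] fun _ : ℕ => (1 : ℝ) := by
  have h : Tendsto (fun n : ℕ => (n : ℂ)⁻¹) atTop (𝓝 0) := tendsto_inv_atTop_nhds_zero_nat
  exact ((p.continuous.tendsto 0).comp h).isBigO_one ℝ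

namespace HasInvExpansion

theorem isBigO_one {u : ℕ → ℂ} {a : PowerSeries ℂ} (h : HasInvExpansion u a) :
    u =O[atTop] fun _ : ℕ => (1 : ℝ) := by
  simpa using h 0

theorem mul {u v : ℕ → ℂ} {a b : PowerSeries ℂ} (hu : HasInvExpansion u a)
    (hv : HasInvExpansion v b) : HasInvExpansion (fun n => u n * v n) (a * b) := by
  intro J
  -- the product of the truncations and the truncation of the product agree modulo `X ^ J`
  obtain ⟨q, hq⟩ : Polynomial.X ^ J ∣ PowerSeries.trunc J a * PowerSeries.trunc J b -
      PowerSeries.trunc J (a * b) := by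
    rw [Polynomial.X_pow_dvd_iff]
    intro d hd
    rw [Polynomial.coeff_sub, PowerSeries.coeff_trunc, if_pos hd,
      PowerSeries.coeff_mul_eq_coeff_trunc_mul_trunc a b hd, ← Polynomial.coe_mul,
      Polynomial.coeff_coe, sub_self]
  have hX : (fun n : ℕ => ((n : ℂ)⁻¹) ^ J) =O[atTop] fun n : ℕ => ((n : ℝ)⁻¹) ^ J :=
    Asymptotics.isBigO_of_le _ fun n => by simp
  have h1 := (hu J).mul hv.isBigO_one
  have h2 := (isBigO_eval_inv_natCast (PowerSeries.trunc J a)).mul (hv J)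
  have h3 := hX.mul (isBigO_eval_inv_natCast q)
  simp only [mul_one, one_mul] at h1 h2 h3
  refine ((h1.add h2).add h3).congr_left fun n => ?_
  have := congrArg (Polynomial.eval (n : ℂ)⁻¹) hq
  simp only [Polynomial.eval_sub, Polynomial.eval_mul, Polynomial.eval_pow,
    Polynomial.eval_X] at this
  rw [← this]
  ring

theorem one : HasInvExpansion (fun _ => 1) 1 := by
  rintro (_ | J)
  · simpa using Asymptotics.isBigO_const_const (1 : ℂ) (one_ne_zero' ℝ) atTop
  · simp [PowerSeries.trunc_one, Asymptotics.isBigO_zero]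

theorem pow {u : ℕ → ℂ} {a : PowerSeries ℂ} (hu : HasInvExpansion u a) (p : ℕ) :
    HasInvExpansion (fun n => u n ^ p) (a ^ p) := by
  induction p with
  | zero => simpa using one
  | succ p ih => simpa only [pow_succ] using ih.mul hu

theorem const_mul {u : ℕ → ℂ} {a : PowerSeries ℂ} (hu : HasInvExpansion u a) (c : ℂ) :
    HasInvExpansion (fun n => c * u n) (PowerSeries.C c * a) := by
  intro J
  refine ((hu J).const_mul_left c).congr_left fun n => ?_
  have : PowerSeries.trunc J (PowerSeries.C c * a) = Polynomial.C c * PowerSeries.trunc J a :=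
    PowerSeries.trunc_C_mul J c a
  rw [this, Polynomial.eval_mul, Polynomial.eval_C, mul_sub]

end HasInvExpansion

/-- `Hₙ - log n` has the asymptotic expansion `γ + f(1 / n)`. -/
theorem hasInvExpansion_harmonic_sub_log :
    HasInvExpansion (fun n => (harmonic n : ℂ) - (Real.log n : ℂ))
      (PowerSeries.C (Real.eulerMascheroniConstant : ℂ) + zetaPowerSeries) := by
  rintro (_ | J)
  · have h := (Complex.continuous_ofReal.tendsto _).comp Real.tendsto_harmonic_sub_log
    simpa [Function.comp_def] using h.isBigO_one ℝ
  · obtain ⟨C, hC⟩ := exists_abs_harmonic_sub_le J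
    refine Asymptotics.IsBigO.of_bound C ?_
    filter_upwards [eventually_ge_atTop 1] with n hn
    have h := hC n hn
    rw [Real.norm_of_nonneg (by positivity)]
    refine le_trans (le_of_eq ?_) h
    rw [← Real.norm_eq_abs, ← Complex.norm_real, Polynomial.eval,
      PowerSeries.eval₂_trunc_eq_sum_range, Finset.sum_range_succ']
    congr 1
    simp [coeff_zetaPowerSeries, constantCoeff_zetaPowerSeries]
    ring

/-! ### Dirichlet series of powers of the logarithm -/

noncomputable section

/-- The meromorphic continuation `k! / (s - 1) ^ (k + 1) + (-1) ^ k ζ₀⁽ᵏ⁾(s)` of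
`∑ (log n) ^ k / n ^ s`, where `ζ₀(s) = ζ(s) - 1 / (s - 1)` is entire. -/
def logPowZeta (k : ℕ) (s : ℂ) : ℂ :=
  (k.factorial : ℂ) / (s - 1) ^ (k + 1) + (-1) ^ k * iteratedDeriv k riemannZeta₀ s

theorem analyticAt_iteratedDeriv_riemannZeta₀ (k : ℕ) (s : ℂ) :
    AnalyticAt ℂ (iteratedDeriv k riemannZeta₀) s := by
  rw [iteratedDeriv_eq_iterate]
  exact (differentiable_riemannZeta₀.analyticAt s).iterated_deriv k

theorem iteratedDeriv_inv_sub_one (k : ℕ) (s : ℂ) :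
    iteratedDeriv k (fun z : ℂ => (z - 1)⁻¹) s = (-1) ^ k * (k.factorial / (s - 1) ^ (k + 1)) := by
  rw [iteratedDeriv_comp_sub_const k Inv.inv 1, iteratedDeriv_eq_iterate]
  beta_reduce
  rw [iter_deriv_inv,
    show (-1 - k : ℤ) = -((k + 1 : ℕ) : ℤ) by push_cast; ring, zpow_neg, zpow_natCast,
    mul_assoc, div_eq_mul_inv]

theorem logMul_iterate_one (k n : ℕ) : LSeries.logMul^[k] 1 n = (Real.log n : ℂ) ^ k := by
  induction k generalizing n with
  | zero => simp
  | succ k ih =>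
    rw [Function.iterate_succ_apply', LSeries.logMul, ih, pow_succ', Complex.natCast_log]

theorem LSeriesHasSum_log_pow (k : ℕ) {s : ℂ} (hs : 1 < s.re) :
    LSeriesHasSum (fun n => (Real.log n : ℂ) ^ k) s (logPowZeta k s) := by
  have habs : LSeries.abscissaOfAbsConv (1 : ℕ → ℂ) < s.re := by
    rw [LSeries.abscissaOfAbsConv_one]; exact_mod_cast hs
  have hfun : LSeries.logMul^[k] (1 : ℕ → ℂ) = fun n : ℕ => (Real.log n : ℂ) ^ k :=
    funext (logMul_iterate_one k)
  have hsum : LSeriesSummable (fun n : ℕ => (Real.log n : ℂ) ^ k) s := by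
    rw [← hfun]
    refine LSeriesSummable_of_abscissaOfAbsConv_lt_re ?_
    rwa [LSeries.absicssaOfAbsConv_logPowMul]
  have hev : LSeries (1 : ℕ → ℂ) =ᶠ[𝓝 s] fun z => (z - 1)⁻¹ + riemannZeta₀ z := by
    filter_upwards [(isOpen_lt continuous_const Complex.continuous_re).mem_nhds hs] with z hz
    rw [LSeries_one_eq_riemannZeta hz]
    refine riemannZeta_eq_inv_sub_add ?_
    rintro rfl
    simp at hz
  have hs1 : s - 1 ≠ 0 := by
    rintro h
    rw [sub_eq_zero.mp h] at hs
    simp at hs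
  have h := LSeries_iteratedDeriv k habs
  have hinv : AnalyticAt ℂ (fun z : ℂ => (z - 1)⁻¹) s := by fun_prop (disch := exact hs1)
  rw [hfun, hev.iteratedDeriv_eq, iteratedDeriv_fun_add hinv.contDiffAt
    (differentiable_riemannZeta₀.analyticAt s).contDiffAt, iteratedDeriv_inv_sub_one] at h
  have hval : LSeries (fun n : ℕ => (Real.log n : ℂ) ^ k) s = logPowZeta k s := by
    have h1 : ((-1 : ℂ) ^ k) * (-1) ^ k = 1 := by rw [← mul_pow]; simp
    rw [logPowZeta]
    linear_combination (-1) ^ k * (-h) + (k.factorial / (s - 1) ^ (k + 1)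
      - LSeries (fun n : ℕ => (Real.log n : ℂ) ^ k) s) * h1
  exact hval ▸ hsum.LSeriesHasSum

theorem LSeriesHasSum_log_pow_mul_inv_pow (k j : ℕ) {s : ℂ} (hs : 1 < (s + j).re) :
    LSeriesHasSum (fun n => (Real.log n : ℂ) ^ k * ((n : ℂ)⁻¹) ^ j) s (logPowZeta k (s + j)) := by
  refine HasSum.congr_fun (LSeriesHasSum_log_pow k hs) fun n => ?_
  rcases eq_or_ne n 0 with rfl | hn
  · simp
  have hn0 : (n : ℂ) ≠ 0 := Nat.cast_ne_zero.mpr hn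
  rw [LSeries.term_of_ne_zero hn, LSeries.term_of_ne_zero hn, Complex.cpow_add _ _ hn0,
    Complex.cpow_natCast, inv_pow]
  field_simp

/-! ### The meromorphic continuation -/

/-- The power series `(m choose k) (γ + f(x)) ^ (m - k)` with which `(log n) ^ k` is multiplied in
the asymptotic expansion of `Hₙ ^ m`, where `x = 1 / n`. -/
def logCoeffSeries (m k : ℕ) : PowerSeries ℂ :=
  PowerSeries.C (m.choose k : ℂ) *
    (PowerSeries.C (Real.eulerMascheroniConstant : ℂ) + zetaPowerSeries) ^ (m - k)

/-- The remainder of the asymptotic expansion of `Hₙ ^ m` before the order `J`. -/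
def harmonicPowRemainder (m J n : ℕ) : ℂ :=
  (harmonic n : ℂ) ^ m - ∑ k ∈ Finset.range (m + 1), ∑ j ∈ Finset.range J,
    PowerSeries.coeff j (logCoeffSeries m k) * ((Real.log n : ℂ) ^ k * ((n : ℂ)⁻¹) ^ j)

theorem isBigO_harmonicPowRemainder (m J : ℕ) :
    harmonicPowRemainder m J =O[atTop] fun n : ℕ => (n : ℝ) ^ (1 - J : ℝ) := by
  have hlog : ∀ k : ℕ, (fun n : ℕ => (Real.log n : ℂ) ^ k) =O[atTop] fun n : ℕ => (n : ℝ) :=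
    fun k => by
    have h := (Real.isLittleO_pow_log_id_atTop (n := k)).isBigO.comp_tendsto
      (tendsto_natCast_atTop_atTop (R := ℝ))
    refine (Asymptotics.IsBigO.of_norm_left (f' := fun n : ℕ => (Real.log n : ℂ) ^ k)
      (h.norm_left.congr_left fun n => ?_))
    simp only [Function.comp_apply, norm_pow, Complex.norm_real]
  have hterm : ∀ k : ℕ, (fun n : ℕ => (Real.log n : ℂ) ^ k *
      ((m.choose k : ℂ) * ((harmonic n : ℂ) - (Real.log n : ℂ)) ^ (m - k) -
        (PowerSeries.trunc J (logCoeffSeries m k)).eval (n : ℂ)⁻¹)) =O[atTop]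
      fun n : ℕ => (n : ℝ) * ((n : ℝ)⁻¹) ^ J := fun k =>
    (hlog k).mul (((hasInvExpansion_harmonic_sub_log.pow (m - k)).const_mul (m.choose k : ℂ)) J)
  refine ((Asymptotics.IsBigO.fun_sum fun k (_ : k ∈ Finset.range (m + 1)) => hterm k).congr_left
    fun n => ?_).trans_eventuallyEq ?_
  · rw [harmonicPowRemainder]
    nth_rewrite 2 [show (harmonic n : ℂ) = (Real.log n : ℂ) + ((harmonic n : ℂ) - Real.log n) by
      ring]
    rw [add_pow, ← Finset.sum_sub_distrib]
    refine Finset.sum_congr rfl fun k _ => ?_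
    rw [Polynomial.eval, PowerSeries.eval₂_trunc_eq_sum_range, mul_sub, Finset.mul_sum]
    congr 1
    · ring
    · exact Finset.sum_congr rfl fun j _ => by simp only [RingHom.id_apply]; ring
  · filter_upwards [eventually_gt_atTop 0] with n hn
    have hn0 : (0 : ℝ) < n := by exact_mod_cast hn
    rw [Real.rpow_sub hn0, Real.rpow_one, Real.rpow_natCast, inv_pow, div_eq_mul_inv]

theorem abscissaOfAbsConv_harmonicPowRemainder_lt {m J : ℕ} {s : ℂ} (hs : 2 - J < s.re) :
    LSeries.abscissaOfAbsConv (harmonicPowRemainder m J) < s.re := by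
  refine (LSeries.abscissaOfAbsConv_le_of_isBigO_rpow (isBigO_harmonicPowRemainder m J)).trans_lt ?_
  have : (1 - J : ℝ) + 1 < s.re := by linarith
  exact_mod_cast this

/-- The continuation of `∑ Hₙ ^ m / n ^ s` to the half-plane `2 - J < Re s`; elsewhere its values
are meaningless. -/
def harmonicZetaAux (m J : ℕ) (s : ℂ) : ℂ :=
  ∑ k ∈ Finset.range (m + 1), ∑ j ∈ Finset.range J,
    PowerSeries.coeff j (logCoeffSeries m k) * logPowZeta k (s + j) +
  LSeries (harmonicPowRemainder m J) s

theorem LSeriesHasSum_harmonic_pow (m : ℕ) {J : ℕ} (hJ : 1 ≤ J) {s : ℂ} (hs : 1 < s.re) :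
    LSeriesHasSum (fun n : ℕ => (harmonic n : ℂ) ^ m) s (harmonicZetaAux m J s) := by
  have hJ' : (1 : ℝ) ≤ J := by exact_mod_cast hJ
  have h1 := (LSeriesSummable_of_abscissaOfAbsConv_lt_re
    (abscissaOfAbsConv_harmonicPowRemainder_lt (m := m) (J := J) (s := s)
      (by linarith))).LSeriesHasSum
  have h2 := LSeriesHasSum.sum (S := Finset.range (m + 1)) fun k _ =>
    LSeriesHasSum.sum (S := Finset.range J) fun j _ =>
      (LSeriesHasSum_log_pow_mul_inv_pow k j (s := s) (by
        have : (0 : ℝ) ≤ j := Nat.cast_nonneg j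
        rw [Complex.add_re, Complex.natCast_re]; linarith)).smul
          (PowerSeries.coeff j (logCoeffSeries m k))
  have h3 := h2.add h1
  refine (LSeriesHasSum_congr s _ fun {n} _ => ?_).mp h3
  simp [harmonicPowRemainder, Finset.sum_apply]

/-- The continuations to two half-planes agree at every point of the smaller one, poles included:
the summands by which they differ come from Dirichlet series that converge there. -/
theorem harmonicZetaAux_succ (m : ℕ) {J : ℕ} {s : ℂ} (hs : 2 - J < s.re) :
    harmonicZetaAux m (J + 1) s = harmonicZetaAux m J s := by
  have h1 := (LSeriesSummable_of_abscissaOfAbsConv_lt_re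
    (abscissaOfAbsConv_harmonicPowRemainder_lt (m := m) (J := J + 1) (s := s)
      (by push_cast; linarith))).LSeriesHasSum
  have h2 := LSeriesHasSum.sum (S := Finset.range (m + 1)) fun k _ =>
      (LSeriesHasSum_log_pow_mul_inv_pow k J (s := s) (by
        rw [Complex.add_re, Complex.natCast_re]; linarith)).smul
          (PowerSeries.coeff J (logCoeffSeries m k))
  have h3 := (LSeriesHasSum_congr (g := harmonicPowRemainder m J) s _ fun {n} _ => by
    simp [harmonicPowRemainder, Finset.sum_apply, Finset.sum_range_succ _ J,
      Finset.sum_add_distrib]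
    ring).mp (h2.add h1)
  rw [harmonicZetaAux, harmonicZetaAux, h3.LSeries_eq]
  simp only [Finset.sum_range_succ _ J, Finset.sum_add_distrib]
  ring

theorem harmonicZetaAux_eq_of_le (m : ℕ) {J J' : ℕ} (hJ : J ≤ J') {s : ℂ} (hs : 2 - J < s.re) :
    harmonicZetaAux m J' s = harmonicZetaAux m J s := by
  induction J', hJ using Nat.le_induction with
  | base => rfl
  | succ J' hJ ih =>
    have : (J : ℝ) ≤ J' := by exact_mod_cast hJ
    rw [harmonicZetaAux_succ m (by linarith), ih]

/-- The meromorphic continuation of `∑ Hₙ ^ m / n ^ s`, glued from the continuations to half-planes: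
at `s`, the order `⌈2 - Re s⌉₊ + 1` is one for which the half-plane contains `s`. -/
def harmonicZeta (m : ℕ) (s : ℂ) : ℂ :=
  harmonicZetaAux m (⌈2 - s.re⌉₊ + 1) s

theorem harmonicZeta_eq (m : ℕ) {J : ℕ} {s : ℂ} (hs : 2 - J < s.re) :
    harmonicZeta m s = harmonicZetaAux m J s := by
  rcases le_total J (⌈2 - s.re⌉₊ + 1) with h | h
  · exact harmonicZetaAux_eq_of_le m h hs
  · refine (harmonicZetaAux_eq_of_le m h ?_).symm
    have := Nat.le_ceil (2 - s.re)
    push_cast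
    linarith

theorem harmonicZeta_eventuallyEq (m : ℕ) {J : ℕ} {c : ℂ} (hc : 2 - J < c.re) :
    harmonicZeta m =ᶠ[𝓝 c] harmonicZetaAux m J := by
  filter_upwards [(isOpen_lt continuous_const Complex.continuous_re).mem_nhds hc] with z hz
  exact harmonicZeta_eq m hz

theorem analyticAt_LSeries_harmonicPowRemainder {m J : ℕ} {c : ℂ} (hc : 2 - J < c.re) :
    AnalyticAt ℂ (LSeries (harmonicPowRemainder m J)) c :=
  LSeries_analyticOnNhd _ _ (abscissaOfAbsConv_harmonicPowRemainder_lt hc)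

theorem meromorphicAt_logPowZeta_add (k j : ℕ) (c : ℂ) :
    MeromorphicAt (fun s => logPowZeta k (s + j)) c := by
  have h1 : MeromorphicAt (fun s : ℂ => (k.factorial : ℂ) / (s + j - 1) ^ (k + 1)) c := by
    fun_prop
  have h2 : AnalyticAt ℂ (fun s : ℂ => iteratedDeriv k riemannZeta₀ (s + j)) c :=
    (analyticAt_iteratedDeriv_riemannZeta₀ k (c + j)).fun_comp (f := fun s : ℂ => s + j)
      (by fun_prop)
  exact h1.add (analyticAt_const.mul h2).meromorphicAt

theorem isHarmonicZeta_harmonicZeta (m : ℕ) : IsHarmonicZeta m (harmonicZeta m) where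
  meromorphic c _ := by
    obtain ⟨J, hJ⟩ := exists_nat_gt (2 - c.re)
    have hc : 2 - J < c.re := by linarith
    refine MeromorphicAt.congr ?_ ((harmonicZeta_eventuallyEq m hc).symm.filter_mono
      nhdsWithin_le_nhds)
    refine MeromorphicAt.add (MeromorphicAt.fun_sum fun k _ => MeromorphicAt.fun_sum fun j _ => ?_)
      (analyticAt_LSeries_harmonicPowRemainder hc).meromorphicAt
    exact (MeromorphicAt.const _ _).mul (meromorphicAt_logPowZeta_add k j c)
  hasSum s hs := LSeriesHasSum_harmonic_pow m (Nat.le_add_left 1 _) hs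

/-- Near `1 - n` only the summands `logPowZeta k (s + n)` have poles. -/
theorem exists_harmonicZeta_eq_principalPart_add (m n : ℕ) :
    ∃ A : ℂ → ℂ, AnalyticAt ℂ A (1 - n) ∧ ∀ᶠ s in 𝓝[≠] (1 - n : ℂ),
      harmonicZeta m s = ∑ k ∈ Finset.range (m + 1),
        ((m.descFactorial k : ℂ) * PowerSeries.coeff n
          ((PowerSeries.C (Real.eulerMascheroniConstant : ℂ) + zetaPowerSeries) ^ (m - k))) /
          (s - (1 - n)) ^ (k + 1) + A s := by
  have hc : 2 - ((n + 2 : ℕ) : ℝ) < (1 - n : ℂ).re := by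
    push_cast
    rw [Complex.sub_re, Complex.one_re, Complex.natCast_re]
    linarith
  refine ⟨fun s => (∑ k ∈ Finset.range (m + 1), ((∑ j ∈ (Finset.range (n + 2)).erase n,
    PowerSeries.coeff j (logCoeffSeries m k) * logPowZeta k (s + j)) +
      PowerSeries.coeff n (logCoeffSeries m k) * ((-1) ^ k * iteratedDeriv k riemannZeta₀ (s + n))))
    + LSeries (harmonicPowRemainder m (n + 2)) s, ?_, ?_⟩
  · have hreg : ∀ k j : ℕ, AnalyticAt ℂ (fun s : ℂ => iteratedDeriv k riemannZeta₀ (s + j))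
        (1 - n) := fun k j =>
      (analyticAt_iteratedDeriv_riemannZeta₀ k (1 - n + j)).fun_comp (f := fun s : ℂ => s + j)
        (by fun_prop)
    refine AnalyticAt.fun_add (Finset.analyticAt_fun_sum _ fun k _ => AnalyticAt.fun_add
      (Finset.analyticAt_fun_sum _ fun j hj => ?_) ?_) (analyticAt_LSeries_harmonicPowRemainder hc)
    · have hj' : (1 - n + j - 1 : ℂ) ^ (k + 1) ≠ 0 := by
        refine pow_ne_zero _ fun h => (Finset.mem_erase.mp hj).1 ?_
        have : (j : ℂ) = n := by linear_combination h
        exact_mod_cast this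
      have h1 : AnalyticAt ℂ (fun s : ℂ => (k.factorial : ℂ) / (s + j - 1) ^ (k + 1)) (1 - n) := by
        fun_prop (disch := exact hj')
      exact analyticAt_const.mul (h1.add (analyticAt_const.mul (hreg k j)))
    · exact analyticAt_const.mul (analyticAt_const.mul (hreg k n))
  · filter_upwards [(harmonicZeta_eventuallyEq m hc).filter_mono nhdsWithin_le_nhds] with s hs
    rw [hs, harmonicZetaAux, ← add_assoc, ← Finset.sum_add_distrib]
    congr 1
    refine Finset.sum_congr rfl fun k _ => ?_
    rw [← Finset.add_sum_erase _ _ (Finset.mem_range.mpr (by omega : n < n + 2)), logPowZeta,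
      Nat.descFactorial_eq_factorial_mul_choose, logCoeffSeries, PowerSeries.coeff_C_mul,
      show s - (1 - n) = s + n - 1 by ring]
    push_cast
    ring

end

/-! ### Laurent expansions and uniqueness -/

/-- Two meromorphic continuations of the series agree off a discrete set. -/
theorem IsHarmonicZeta.eventuallyEq {m : ℕ} {F G : ℂ → ℂ} (hF : IsHarmonicZeta m F)
    (hG : IsHarmonicZeta m G) (c : ℂ) : F =ᶠ[𝓝[≠] c] G := by
  have hmer : MeromorphicOn (F - G) Set.univ := hF.meromorphic.sub hG.meromorphic
  have h2 : meromorphicOrderAt (F - G) 2 = ⊤ := by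
    rw [meromorphicOrderAt_eq_top_iff]
    refine Filter.Eventually.filter_mono nhdsWithin_le_nhds ?_
    filter_upwards [(isOpen_lt continuous_const Complex.continuous_re).mem_nhds
      (show (1 : ℝ) < (2 : ℂ).re by norm_num)] with z hz
    rw [Pi.sub_apply, (hF.hasSum z hz).unique (hG.hasSum z hz), sub_self]
  have hc : meromorphicOrderAt (F - G) c = ⊤ := by
    by_contra h
    exact hmer.meromorphicOrderAt_ne_top_of_isPreconnected isPreconnected_univ (Set.mem_univ c)
      (Set.mem_univ 2) h h2
  rw [meromorphicOrderAt_eq_top_iff] at hc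
  filter_upwards [hc] with z hz
  exact sub_eq_zero.mp hz

theorem HasLaurentExpansionAt.congr {F G : ℂ → ℂ} {c : ℂ} {b : ℤ → ℂ}
    (h : HasLaurentExpansionAt F c b) (hFG : F =ᶠ[𝓝[≠] c] G) : HasLaurentExpansionAt G c b := by
  refine ⟨h.1, ?_⟩
  filter_upwards [h.2, hFG] with z hz hz'
  exact hz' ▸ hz

/-- A power series that sums to `0` near, but not necessarily at, the centre is `0`. -/
theorem eq_zero_of_eventually_hasSum_zero {a : ℕ → ℂ} {c : ℂ}
    (h : ∀ᶠ z in 𝓝[≠] c, HasSum (fun i : ℕ => a i * (z - c) ^ i) 0) : a = 0 := by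
  let f : ℂ → ℂ := fun z => if z = c then a 0 else 0
  have hf : HasFPowerSeriesAt f (FormalMultilinearSeries.ofScalars ℂ a) c := by
    rw [hasFPowerSeriesAt_iff']
    filter_upwards [eventually_nhdsWithin_iff.mp h] with z hz
    simp only [FormalMultilinearSeries.coeff_ofScalars, smul_eq_mul, f]
    by_cases hzc : z = c
    · rw [if_pos hzc, hzc, sub_self]
      refine (hasSum_ite_eq 0 (a 0)).congr_fun fun i => ?_
      rcases eq_or_ne i 0 with rfl | hi <;> simp [*]
    · rw [if_neg hzc]
      exact (hz hzc).congr_fun fun i => mul_comm _ _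
  -- `f` is continuous at `c`, so `a 0` is the limit of the zero function
  have h0 : a 0 = 0 := by
    have h1 : Tendsto f (𝓝[≠] c) (𝓝 (a 0)) := by
      have := hf.continuousAt.tendsto.mono_left (nhdsWithin_le_nhds (s := {c}ᶜ))
      rwa [show f c = a 0 from if_pos rfl] at this
    refine tendsto_nhds_unique h1 (tendsto_const_nhds.congr' ?_)
    filter_upwards [self_mem_nhdsWithin] with z hz
    exact (if_neg hz).symm
  have hf0 : f = 0 := funext fun z => by simp [f, h0]
  rw [hf0] at hf
  exact (FormalMultilinearSeries.ofScalars_series_eq_zero ℂ).mp hf.eq_zero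

theorem HasLaurentExpansionAt.unique {F : ℂ → ℂ} {c : ℂ} {b b' : ℤ → ℂ}
    (h : HasLaurentExpansionAt F c b) (h' : HasLaurentExpansionAt F c b') : b = b' := by
  obtain ⟨⟨N, hN⟩, hb⟩ := h
  obtain ⟨⟨N', hN'⟩, hb'⟩ := h'
  have key : (fun i : ℕ => b (min N N' + i) - b' (min N N' + i)) = 0 := by
    refine eq_zero_of_eventually_hasSum_zero (c := c) ?_
    filter_upwards [hb, hb', self_mem_nhdsWithin] with z hz hz' hzc
    have hzc : z - c ≠ 0 := sub_ne_zero.mpr hzc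
    have h1 := (hz.sub hz').mul_right ((z - c) ^ (-min N N'))
    rw [sub_self, zero_mul] at h1
    have hinj : Function.Injective fun i : ℕ => min N N' + (i : ℤ) := fun i j hij => by
      simpa using hij
    refine ((hinj.hasSum_iff fun j hj => ?_).mpr h1).congr_fun fun i => ?_
    · have hj' : j < min N N' := by
        by_contra hle
        exact hj ⟨(j - min N N').toNat, by simp only; omega⟩
      rw [hN j (hj'.trans_le (min_le_left _ _)), hN' j (hj'.trans_le (min_le_right _ _))]
      simp
    · simp only [Function.comp_apply]
      rw [← sub_mul, mul_assoc, ← zpow_add₀ hzc, ← zpow_natCast]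
      congr 2
      ring
  funext j
  rcases lt_or_ge j (min N N') with hj | hj
  · rw [hN j (hj.trans_le (min_le_left _ _)), hN' j (hj.trans_le (min_le_right _ _))]
  · have := congrFun key (j - min N N').toNat
    rw [Pi.zero_apply, Int.toNat_of_nonneg (by omega), add_sub_cancel] at this
    exact sub_eq_zero.mp this

/-- A principal part plus an analytic function has a Laurent expansion with the coefficients of the
principal part in negative degrees. -/
theorem exists_hasLaurentExpansionAt {F A : ℂ → ℂ} {c : ℂ} {p : ℕ → ℂ} {M : ℕ}
    (hA : AnalyticAt ℂ A c) (hp : ∀ k, M ≤ k → p k = 0)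
    (hF : ∀ᶠ z in 𝓝[≠] c, F z = ∑ k ∈ Finset.range M, p k / (z - c) ^ (k + 1) + A z) :
    ∃ b : ℤ → ℂ, HasLaurentExpansionAt F c b ∧ ∀ k : ℕ, b (-((k : ℤ) + 1)) = p k := by
  obtain ⟨q, hq⟩ := hA
  refine ⟨Int.rec q.coeff p, ⟨⟨-M, fun j hj => ?_⟩, ?_⟩, fun k => ?_⟩
  · obtain ⟨k, rfl⟩ := Int.eq_negSucc_of_lt_zero (show j < 0 by omega)
    exact hp k (by omega)
  · filter_upwards [hF, hq.eventually_hasSum_sub.filter_mono nhdsWithin_le_nhds] with z hz hsum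
    rw [hz, add_comm]
    refine HasSum.of_nat_of_neg_add_one ?_ ?_
    · refine hsum.congr_fun fun i => ?_
      rw [FormalMultilinearSeries.apply_eq_pow_smul_coeff, smul_eq_mul, mul_comm, zpow_natCast]
      rfl
    · refine (hasSum_sum_of_ne_finset_zero (s := Finset.range M) fun k hk => ?_).congr_fun
        fun k => ?_
      · rw [hp k (by simpa using hk), zero_div]
      · rw [← Int.negSucc_eq, zpow_negSucc, div_eq_mul_inv]
  · rw [← Int.negSucc_eq]

theorem exists_hasLaurentExpansionAt_harmonicZeta (m n : ℕ) :
    ∃ b : ℤ → ℂ, HasLaurentExpansionAt (harmonicZeta m) (1 - n) b ∧ ∀ k : ℕ,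
      b (-((k : ℤ) + 1)) = (m.descFactorial k : ℂ) * PowerSeries.coeff n
        ((PowerSeries.C (Real.eulerMascheroniConstant : ℂ) + zetaPowerSeries) ^ (m - k)) := by
  obtain ⟨A, hA, hF⟩ := exists_harmonicZeta_eq_principalPart_add m n
  refine exists_hasLaurentExpansionAt hA (fun k hk => ?_) hF
  rw [Nat.descFactorial_eq_zero_iff_lt.mpr (by omega), Nat.cast_zero, zero_mul]

theorem mainTheorem1 :
    (∀ n ℓ k : ℕ, 1 ≤ k → ∃ q : ℚ, poleTripleSeq n ℓ k = (q : ℂ)) ∧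
    ∀ m : ℕ, (∃ F : ℂ → ℂ, IsHarmonicZeta m F) ∧
      ∀ F : ℂ → ℂ, IsHarmonicZeta m F →
        (∀ n : ℕ, ∃ b : ℤ → ℂ, HasLaurentExpansionAt F (1 - (n : ℂ)) b) ∧
        ∀ b : ℕ → ℤ → ℂ, (∀ n : ℕ, HasLaurentExpansionAt F (1 - (n : ℂ)) (b n)) →
          (∀ n k : ℕ, 1 ≤ k →
            b n (-(k : ℤ)) = ∑ ℓ ∈ Finset.range (m + 1),
              (m.choose ℓ : ℂ) * (Real.eulerMascheroniConstant : ℂ) ^ (m - ℓ) *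
                poleTripleSeq n ℓ k) ∧
          ∀ k : ℕ,
            PowerSeries.mk (fun n : ℕ => b n (-((k : ℤ) + 1))) =
              (m.descFactorial k : PowerSeries ℂ) *
                (PowerSeries.C (Real.eulerMascheroniConstant : ℂ) + zetaPowerSeries) ^ (m - k) := by
  refine ⟨fun n ℓ k _ => ?_, fun m => ⟨⟨_, isHarmonicZeta_harmonicZeta m⟩, fun F hF => ?_⟩⟩
  · obtain ⟨q, hq⟩ := poleSeq_rational n (ℓ - (k - 1))
    exact ⟨(ℓ.descFactorial (k - 1) : ℚ) * q, by rw [poleTripleSeq, hq]; push_cast; rfl⟩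
  have hlaurent : ∀ n : ℕ, ∃ b : ℤ → ℂ, HasLaurentExpansionAt F (1 - n) b ∧ ∀ k : ℕ,
      b (-((k : ℤ) + 1)) = (m.descFactorial k : ℂ) * PowerSeries.coeff n
        ((PowerSeries.C (Real.eulerMascheroniConstant : ℂ) + zetaPowerSeries) ^ (m - k)) :=
    fun n => by
      obtain ⟨b, hb, hbk⟩ := exists_hasLaurentExpansionAt_harmonicZeta m n
      exact ⟨b, hb.congr ((isHarmonicZeta_harmonicZeta m).eventuallyEq hF _), hbk⟩
  refine ⟨fun n => (hlaurent n).imp fun b hb => hb.1, fun b hb => ?_⟩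
  have hcoeff : ∀ n k : ℕ, b n (-((k : ℤ) + 1)) = (m.descFactorial k : ℂ) * PowerSeries.coeff n
      ((PowerSeries.C (Real.eulerMascheroniConstant : ℂ) + zetaPowerSeries) ^ (m - k)) :=
    fun n k => by
      obtain ⟨b', hb', hbk⟩ := hlaurent n
      rw [(hb n).unique hb', hbk]
  refine ⟨fun n k hk => ?_, fun k => ?_⟩
  · obtain ⟨k, rfl⟩ := Nat.exists_eq_add_of_le' hk
    rw [sum_choose_mul_poleTripleSeq, ← hcoeff]
    push_cast
    rfl
  · ext n
    rw [PowerSeries.coeff_mk, hcoeff, ← map_natCast (PowerSeries.C (R := ℂ)),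
      PowerSeries.coeff_C_mul]
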